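/- Let $G$ be a simplicial group with Moore complex $NG_n=\bigcap_{i=0}^{n-1}\ker(d_i\colon G_n\to G_{n-1})$ and $\partial_n=d_n|_{NG_n}$, and let $D_n\le G_n$ be the subgroup generated by the degenerate elements. The 3-crossed module of $G$ has underlying complex of groups $$K\xrightarrow{\partial_3}L\xrightarrow{\partial_2}M\xrightarrow{\partial_1}N,\qquad K=NG_3/\partial_4(NG_4\cap D_4),\quad L=NG_2,\quad M=NG_1,\quad N=NG_0,$$ with maps induced by the differentials of $NG$. Its homotopy groups are $$\pi'_0=0,\quad \pi'_1=N/\operatorname{im}\partial_1,\quad \pi'_2=\ker\partial_1/\operatorname{im}\partial_2,\quad \pi'_3=\ker\partial_2/\operatorname{im}\partial_3,\quad \pi'_4=\ker\partial_3 .$$ Let $\pi_n$ be the homotopy groups of the classifying space $\overline{W}G$ of $G$ (a Kan complex) at its unique vertex; for $n=0$ this is the pointed set of components. Then $\pi_n\cong\pi'_n$ for $n=0,1,2,3$, and $\pi_4\cong\pi'_4$ whenever $NG_4\subseteq D_4$, in particular whenever the Moore complex of $G$ has length $3$ (that is, $NG_n=1$ for all $n\ge 4$, in which case $K=NG_3$).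 The isomorphisms are of groups for $n\ge1$ and of pointed sets for $n=0$. -/

import Mathlib

open CategoryTheory Opposite Simplicial

universe u

namespace ThreeCrossed

/-! ### The Moore complex of a simplicial group -/

/-- `NG_n`, the intersection of the kernels of `d_0, …, d_{n-1}` (so `NG_0 = G_0`). -/
def moore (G : SimplicialObject GrpCat.{u}) (n : ℕ) : Subgroup (G _⦋n⦌) :=
  match n with
  | 0 => ⊤
  | n + 1 => ⨅ i : Fin (n + 1), (G.δ i.castSucc).hom.ker

/-- `D_n`, the subgroup of `G_n` generated by the degenerate elements. -/
def degen (G : SimplicialObject GrpCat.{u}) (n : ℕ) : Subgroup (G _⦋n⦌) :=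
  match n with
  | 0 => ⊥
  | n + 1 => ⨆ i : Fin (n + 1), (G.σ i).hom.range

theorem mem_moore_succ {G : SimplicialObject GrpCat.{u}} {n : ℕ} {x : G _⦋n + 1⦌} :
    x ∈ moore G (n + 1) ↔ ∀ i : Fin (n + 1), G.δ i.castSucc x = 1 := by
  simp only [moore, Subgroup.mem_iInf]
  rfl

instance moore_normal (G : SimplicialObject GrpCat.{u}) (n : ℕ) : (moore G n).Normal := by
  cases n with
  | zero => exact inferInstanceAs (⊤ : Subgroup (G _⦋0⦌)).Normal
  | succ n => exact Subgroup.normal_iInf_normal fun i => MonoidHom.normal_ker _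

theorem δ_last_mem (G : SimplicialObject GrpCat.{u}) (n : ℕ) {x : G _⦋n + 1⦌}
    (hx : x ∈ moore G (n + 1)) : G.δ (Fin.last (n + 1)) x ∈ moore G n := by
  cases n with
  | zero => exact Subgroup.mem_top _
  | succ n =>
    rw [mem_moore_succ] at hx ⊢
    intro i
    have h := G.δ_comp_δ (i := i.castSucc) (j := Fin.last (n + 1)) (Fin.le_last _)
    have h2 := ConcreteCategory.congr_hom h x
    simp only [Fin.succ_last] at h2
    rw [CategoryTheory.comp_apply, CategoryTheory.comp_apply, hx i.castSucc, map_one] at h2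
    exact h2

/-- The differential `∂_{n+1} : NG_{n+1} → NG_n`, the restriction of `d_{n+1}`. -/
def mooreD (G : SimplicialObject GrpCat.{u}) (n : ℕ) : moore G (n + 1) →* moore G n :=
  ((G.δ (Fin.last (n + 1))).hom.comp (moore G (n + 1)).subtype).codRestrict (moore G n)
    fun x => δ_last_mem G n x.2

theorem mooreD_coe (G : SimplicialObject GrpCat.{u}) (n : ℕ) (x : moore G (n + 1)) :
    (mooreD G n x : G _⦋n⦌) = G.δ (Fin.last (n + 1)) (x : G _⦋n + 1⦌) := rfl

theorem mooreD_mooreD (G : SimplicialObject GrpCat.{u}) (n : ℕ) (x : moore G (n + 2)) :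
    mooreD G n (mooreD G (n + 1) x) = 1 := by
  apply Subtype.ext
  have h := G.δ_comp_δ (i := Fin.last (n + 1)) (j := Fin.last (n + 1)) le_rfl
  have h2 := ConcreteCategory.congr_hom h (x : G _⦋n + 2⦌)
  simp only [Fin.succ_last] at h2
  rw [CategoryTheory.comp_apply, CategoryTheory.comp_apply, mem_moore_succ.1 x.2 (Fin.last (n + 1)),
    map_one] at h2
  rw [mooreD_coe, mooreD_coe]
  exact h2

/-- Conjugates of a boundary are boundaries of conjugates by degenerate elements. -/
theorem conj_mooreD (G : SimplicialObject GrpCat.{u}) (n : ℕ) (y : moore G (n + 1))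
    (x : moore G n) :
    x * mooreD G n y * x⁻¹ = mooreD G n ⟨G.σ (Fin.last n) (x : G _⦋n⦌) * (y : G _⦋n + 1⦌) *
      (G.σ (Fin.last n) (x : G _⦋n⦌))⁻¹, (moore_normal G (n + 1)).conj_mem _ y.2 _⟩ := by
  have h := ConcreteCategory.congr_hom (G.δ_comp_σ_succ (i := Fin.last n)) (x : G _⦋n⦌)
  rw [Fin.succ_last, CategoryTheory.comp_apply] at h
  apply Subtype.ext
  simp only [Subgroup.coe_mul, Subgroup.coe_inv, mooreD_coe, map_mul, map_inv, h]
  rfl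

theorem mooreD_range_normal (G : SimplicialObject GrpCat.{u}) (n : ℕ) :
    (mooreD G n).range.Normal := by
  constructor
  rintro _ ⟨y, rfl⟩ x
  exact ⟨_, (conj_mooreD G n y x).symm⟩

/-! ### Complexes of groups of length three and their homotopy groups -/

/-- A complex of groups `K → L → M → N` in which every image is a normal subgroup. The underlying
complex of every 3-crossed module is of this kind. -/
structure GroupComplex where
  /-- the group in degree three -/
  K : Type u
  /-- the group in degree two -/
  L : Type u
  /-- the group in degree one -/
  M : Type u
  /-- the group in degree zero -/
  N : Type u
  [groupK : Group K]
  [groupL : Group L]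
  [groupM : Group M]
  [groupN : Group N]
  /-- the map `∂₃` -/
  d₃ : K →* L
  /-- the map `∂₂` -/
  d₂ : L →* M
  /-- the map `∂₁` -/
  d₁ : M →* N
  d₂_d₃ : ∀ k, d₂ (d₃ k) = 1
  d₁_d₂ : ∀ l, d₁ (d₂ l) = 1
  normal₃ : d₃.range.Normal
  normal₂ : d₂.range.Normal
  normal₁ : d₁.range.Normal

namespace GroupComplex

attribute [instance] groupK groupL groupM groupN normal₃ normal₂ normal₁

/-- The homotopy groups `π'_n` of a complex `K → L → M → N`: they are `N / im ∂₁`,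
`ker ∂₁ / im ∂₂`, `ker ∂₂ / im ∂₃`, `ker ∂₃` for `n = 1, 2, 3, 4`, and trivial otherwise. -/
def Pi (C : GroupComplex.{u}) (n : ℕ) : Type u :=
  match n with
  | 1 => C.N ⧸ C.d₁.range
  | 2 => C.d₁.ker ⧸ C.d₂.range.subgroupOf C.d₁.ker
  | 3 => C.d₂.ker ⧸ C.d₃.range.subgroupOf C.d₂.ker
  | 4 => C.d₃.ker
  | _ => PUnit

instance groupPi (C : GroupComplex.{u}) (n : ℕ) : Group (C.Pi n) :=
  match n with
  | 0 => inferInstanceAs (Group PUnit)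
  | 1 => inferInstanceAs (Group (C.N ⧸ C.d₁.range))
  | 2 => inferInstanceAs (Group (C.d₁.ker ⧸ C.d₂.range.subgroupOf C.d₁.ker))
  | 3 => inferInstanceAs (Group (C.d₂.ker ⧸ C.d₃.range.subgroupOf C.d₂.ker))
  | 4 => inferInstanceAs (Group C.d₃.ker)
  | _ + 5 => inferInstanceAs (Group PUnit)

end GroupComplex

/-- `∂_4(NG_4 ∩ D_4)`, as a subgroup of `NG_3`. -/
def degenBoundary (G : SimplicialObject GrpCat.{u}) : Subgroup (moore G 3) :=
  ((degen G 4).subgroupOf (moore G 4)).map (mooreD G 3)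

instance degenBoundary_normal (G : SimplicialObject GrpCat.{u}) : (degenBoundary G).Normal := by
  constructor
  rintro _ ⟨y, hy, rfl⟩ x
  refine ⟨_, ?_, (conj_mooreD G 3 y x).symm⟩
  have hs : G.σ (Fin.last 3) (x : G _⦋3⦌) ∈ degen G 4 :=
    Subgroup.mem_iSup_of_mem (S := fun i : Fin 4 => (G.σ i).hom.range) (Fin.last 3) ⟨_, rfl⟩
  exact (degen G 4).mul_mem ((degen G 4).mul_mem hs hy) ((degen G 4).inv_mem hs)

theorem degenBoundary_le (G : SimplicialObject GrpCat.{u}) :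
    degenBoundary G ≤ (mooreD G 2).ker := by
  rintro _ ⟨y, -, rfl⟩
  exact mooreD_mooreD G 2 y

/-- The complex `NG_3 / ∂_4(NG_4 ∩ D_4) → NG_2 → NG_1 → NG_0` underlying the 3-crossed module
of the simplicial group `G`. -/
def assocComplex (G : SimplicialObject GrpCat.{u}) : GroupComplex.{u} where
  K := moore G 3 ⧸ degenBoundary G
  L := moore G 2
  M := moore G 1
  N := moore G 0
  d₃ := QuotientGroup.lift (degenBoundary G) (mooreD G 2) fun _ h => degenBoundary_le G h
  d₂ := mooreD G 1
  d₁ := mooreD G 0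
  d₂_d₃ k := by
    obtain ⟨k, rfl⟩ := QuotientGroup.mk_surjective k
    exact mooreD_mooreD G 1 k
  d₁_d₂ := mooreD_mooreD G 0
  normal₃ := by
    constructor
    rintro _ ⟨k, rfl⟩ x
    obtain ⟨k, rfl⟩ := QuotientGroup.mk_surjective k
    obtain ⟨z, hz⟩ := (mooreD_range_normal G 2).conj_mem _ ⟨k, rfl⟩ x
    exact ⟨QuotientGroup.mk z, hz⟩
  normal₂ := mooreD_range_normal G 1
  normal₁ := mooreD_range_normal G 0

/-! ### The classifying space of a simplicial group -/

/-- The value of a monotone map `ψ : [j] → [n]` at the vertex `t`, as a natural number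
(at the last vertex if `t > j`). -/
def vertex {j n : ℕ} (ψ : ⦋j⦌ ⟶ ⦋n⦌) (t : ℕ) : ℕ :=
  (ψ.toOrderHom (⟨min t j, Nat.lt_succ_of_le (min_le_right t j)⟩ : Fin (j + 1)) : Fin (n + 1))

theorem vertex_le {j n : ℕ} (ψ : ⦋j⦌ ⟶ ⦋n⦌) (t : ℕ) : vertex ψ t ≤ n :=
  Nat.le_of_lt_succ (Fin.isLt (n := n + 1) _)

theorem vertex_mono {j n : ℕ} (ψ : ⦋j⦌ ⟶ ⦋n⦌) {s t : ℕ} (h : s ≤ t) :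
    vertex ψ s ≤ vertex ψ t :=
  ψ.toOrderHom.monotone (Fin.mk_le_mk.2 (min_le_min_right j h))

theorem vertex_min {j n : ℕ} (ψ : ⦋j⦌ ⟶ ⦋n⦌) (t : ℕ) : vertex ψ (min t j) = vertex ψ t := by
  simp [vertex]

theorem vertex_id {n : ℕ} (t : ℕ) : vertex (𝟙 ⦋n⦌) t = min t n := rfl

theorem vertex_comp {i j n : ℕ} (φ : ⦋i⦌ ⟶ ⦋j⦌) (ψ : ⦋j⦌ ⟶ ⦋n⦌) (t : ℕ) :
    vertex (φ ≫ ψ) t = vertex ψ (vertex φ t) := by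
  have h := vertex_le φ t
  simp only [vertex] at h ⊢
  simp only [min_eq_left h]
  rfl

theorem hom_ext {j n : ℕ} {φ ψ : ⦋j⦌ ⟶ ⦋n⦌} (h : ∀ t, t ≤ j → vertex φ t = vertex ψ t) :
    φ = ψ := by
  ext t : 3
  have ht : (t : ℕ) ≤ j := Nat.le_of_lt_succ t.isLt
  have h2 := h t ht
  simp only [vertex, min_eq_left ht] at h2
  exact Fin.ext h2

/-- The monotone map `[j] → [n]` with given values. -/
def natHom {j n : ℕ} (f : ℕ → ℕ) (hf : Monotone f) (hn : ∀ t, t ≤ j → f t ≤ n) : ⦋j⦌ ⟶ ⦋n⦌ :=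
  SimplexCategory.mkHom
    { toFun := fun t : Fin (j + 1) => (⟨f t, Nat.lt_succ_of_le
        (hn t (Nat.le_of_lt_succ t.isLt))⟩ : Fin (n + 1))
      monotone' := fun _ _ h => Fin.mk_le_mk.2 (hf h) }

theorem vertex_natHom {j n : ℕ} (f : ℕ → ℕ) (hf : Monotone f) (hn : ∀ t, t ≤ j → f t ≤ n)
    (t : ℕ) : vertex (natHom f hf hn) t = f (min t j) := rfl

/-- The monotone map `[j] → [i]`, `t ↦ ψ(t) + i - n`: when `ψ : [j] → [n]` takes its values in
the last `i + 1` vertices of `[n]`, this is `ψ` with these vertices renumbered `0, …, i`. -/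
def toLast {j n : ℕ} (ψ : ⦋j⦌ ⟶ ⦋n⦌) (i : ℕ) : ⦋j⦌ ⟶ ⦋i⦌ :=
  natHom (fun t => vertex ψ t + i - n) (fun s t h => by have := vertex_mono ψ h; grind)
    (fun t _ => by have := vertex_le ψ t; omega)

/-- The inclusion `[j] → [n]` of the last `j + 1` vertices, `t ↦ t + (n - j)`. -/
def lastVertices {j n : ℕ} (h : j ≤ n) : ⦋j⦌ ⟶ ⦋n⦌ :=
  natHom (fun t => t + (n - j)) (fun s t h => by grind) (fun t _ => by omega)

theorem vertex_toLast {j n : ℕ} (ψ : ⦋j⦌ ⟶ ⦋n⦌) (i t : ℕ) :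
    vertex (toLast ψ i) t = vertex ψ (min t j) + i - n := rfl

theorem vertex_lastVertices {j n : ℕ} (h : j ≤ n) (t : ℕ) :
    vertex (lastVertices h) t = min t j + (n - j) := rfl

/-- The product of the `ψ^* g_{n-k}` over `a < k ≤ b` in increasing order of `k`, where `ψ` takes
its values in the vertices `≥ b` of `[n]` and `g_{n-k} ∈ G_{n-k}` lives on the vertices
`k, …, n`. -/
def transition (G : SimplicialObject GrpCat.{u}) {n : ℕ} (g : (i : Fin n) → G _⦋i⦌) (a b : ℕ)
    {j : ℕ} (ψ : ⦋j⦌ ⟶ ⦋n⦌) : G _⦋j⦌ :=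
  ((List.Ico (a + 1) (b + 1)).map fun k =>
    if h : n - k < n then G.map (toLast ψ (n - k)).op (g ⟨n - k, h⟩) else 1).prod

/-- The structure map of the classifying complex for `θ : [m] → [n]`: the component in `G_j` of
`θ^* (g_{n-1}, …, g_0)` is the transition from `θ(m-j-1)` to `θ(m-j)`. -/
def wbarMap (G : SimplicialObject GrpCat.{u}) {m n : ℕ} (θ : ⦋m⦌ ⟶ ⦋n⦌)
    (g : (i : Fin n) → G _⦋i⦌) : (j : Fin m) → G _⦋j⦌ := fun j =>
  transition G g (vertex θ (m - j - 1)) (vertex θ (m - j)) (lastVertices j.isLt.le ≫ θ)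

theorem map_transition (G : SimplicialObject GrpCat.{u}) {n : ℕ} (g : (i : Fin n) → G _⦋i⦌)
    (a b : ℕ) {i j : ℕ} (φ : ⦋i⦌ ⟶ ⦋j⦌) (ψ : ⦋j⦌ ⟶ ⦋n⦌) :
    G.map φ.op (transition G g a b ψ) = transition G g a b (φ ≫ ψ) := by
  rw [transition, transition, map_list_prod, List.map_map]
  congr 2
  funext k
  simp only [Function.comp]
  split_ifs
  · have h : φ ≫ toLast ψ (n - k) = toLast (φ ≫ ψ) (n - k) := by
      refine hom_ext fun t ht => ?_
      have := vertex_le φ t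
      simp only [vertex_toLast, vertex_comp, min_eq_left ht, min_eq_left this]
    rw [← h, ← CategoryTheory.comp_apply, ← Functor.map_comp, ← op_comp]
  · exact map_one _

theorem transition_mul (G : SimplicialObject GrpCat.{u}) {n : ℕ} (g : (i : Fin n) → G _⦋i⦌)
    {a b c : ℕ} (hab : a ≤ b) (hbc : b ≤ c) {j : ℕ} (ψ : ⦋j⦌ ⟶ ⦋n⦌) :
    transition G g a b ψ * transition G g b c ψ = transition G g a c ψ := by
  simp only [transition]
  rw [← List.prod_append, ← List.map_append, List.Ico.append_consecutive (by omega) (by omega)]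

theorem prod_transition (G : SimplicialObject GrpCat.{u}) {n : ℕ} (g : (i : Fin n) → G _⦋i⦌)
    {j : ℕ} (ψ : ⦋j⦌ ⟶ ⦋n⦌) (f : ℕ → ℕ) (a b : ℕ) (hab : a ≤ b)
    (hf : ∀ s t, s ≤ t → t ≤ b → f s ≤ f t) :
    ((List.Ico (a + 1) (b + 1)).map fun k => transition G g (f (k - 1)) (f k) ψ).prod =
      transition G g (f a) (f b) ψ := by
  induction b, hab using Nat.le_induction with
  | base => simp [transition]
  | succ b hb ih =>
    rw [List.Ico.succ_top (by omega), List.map_append, List.prod_append,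
      ih (fun s t h h2 => hf s t h (by omega))]
    simp only [List.map_cons, List.map_nil, List.prod_cons, List.prod_nil, mul_one,
      Nat.add_sub_cancel]
    exact transition_mul G g (hf _ _ hb (by omega)) (hf _ _ (by omega) le_rfl) ψ

theorem wbarMap_id (G : SimplicialObject GrpCat.{u}) {n : ℕ} (g : (i : Fin n) → G _⦋i⦌) :
    wbarMap G (𝟙 ⦋n⦌) g = g := by
  funext ⟨j, hj⟩
  have h2 : toLast (lastVertices hj.le ≫ 𝟙 ⦋n⦌) j = 𝟙 ⦋j⦌ := by
    refine hom_ext fun t ht => ?_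
    simp only [vertex_toLast, vertex_lastVertices, vertex_comp, vertex_id, min_eq_left ht]
    omega
  have key : ∀ k (h : k < n), k = j →
      G.map (toLast (lastVertices hj.le ≫ 𝟙 ⦋n⦌) k).op (g ⟨k, h⟩) = g ⟨j, hj⟩ := by
    rintro k h rfl
    rw [h2, op_id, G.map_id]
    rfl
  have e2 : List.Ico (min (n - j - 1) n + 1) (min (n - j) n + 1) = [n - j] := by
    rw [show min (n - j - 1) n + 1 = n - j by omega, show min (n - j) n + 1 = n - j + 1 by omega]
    exact List.Ico.succ_singleton
  simp only [wbarMap, transition, vertex_id]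
  rw [e2]
  simp only [List.map_cons, List.map_nil, List.prod_cons, List.prod_nil, mul_one]
  rw [dif_pos (by omega : n - (n - j) < n)]
  exact key _ _ (by omega)

theorem wbarMap_comp (G : SimplicialObject GrpCat.{u}) {l m n : ℕ} (φ : ⦋l⦌ ⟶ ⦋m⦌)
    (θ : ⦋m⦌ ⟶ ⦋n⦌) (g : (i : Fin n) → G _⦋i⦌) :
    wbarMap G (φ ≫ θ) g = wbarMap G φ (wbarMap G θ g) := by
  funext ⟨j, hj⟩
  simp only [wbarMap, vertex_comp]
  rw [← Category.assoc, ← prod_transition G g _ (vertex θ) _ _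
    (vertex_mono φ (by omega)) (fun s t h _ => vertex_mono θ h)]
  rw [transition]
  congr 1
  refine List.map_congr_left fun k hk => ?_
  rw [List.Ico.mem] at hk
  have hb := vertex_le φ (l - j)
  have hlt : m - k < m := by omega
  have e1 : m - (m - k) = k := by omega
  rw [dif_pos hlt]
  change _ = G.map _ (transition G g (vertex θ (m - (m - k) - 1)) (vertex θ (m - (m - k)))
    (lastVertices hlt.le ≫ θ))
  rw [map_transition]
  have e3 : (lastVertices hj.le ≫ φ) ≫ θ =
      toLast (lastVertices hj.le ≫ φ) (m - k) ≫ lastVertices hlt.le ≫ θ := by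
    rw [← Category.assoc]
    congr 1
    refine hom_ext fun t ht => ?_
    have h1 : vertex φ (l - j) ≤ vertex φ (min t j + (l - j)) := vertex_mono φ (by omega)
    have h2 := vertex_le φ (min t j + (l - j))
    simp only [vertex_toLast, vertex_lastVertices, vertex_comp, min_eq_left ht] at h1 h2 ⊢
    omega
  simp only [e1]
  rw [e3]

/-- The classifying space `W̄G` of a simplicial group, as a simplicial set. Its `n`-simplices are
the tuples `(g_{n-1}, …, g_0)` with `g_i ∈ G_i`. -/
def wbar (G : SimplicialObject GrpCat.{u}) : SSet.{u} where
  obj n := (i : Fin n.unop.len) → G _⦋i⦌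
  map θ := TypeCat.ofHom fun g => wbarMap G θ.unop g
  map_id _ := by
    apply ConcreteCategory.hom_ext
    intro g
    exact wbarMap_id G g
  map_comp φ θ := by
    apply ConcreteCategory.hom_ext
    intro g
    exact wbarMap_comp G θ.unop φ.unop g

theorem transition_succ (G : SimplicialObject GrpCat.{u}) {n : ℕ} (g : (i : Fin n) → G _⦋i⦌)
    (a : ℕ) {j i : ℕ} (ψ : ⦋j⦌ ⟶ ⦋n⦌) (hi : i < n) (ha : a + 1 + i = n) :
    transition G g a (a + 1) ψ = G.map (toLast ψ i).op (g ⟨i, hi⟩) := by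
  obtain rfl : i = n - (a + 1) := by omega
  rw [transition, List.Ico.succ_singleton]
  simp only [List.map_cons, List.map_nil, List.prod_cons, List.prod_nil, mul_one]
  rw [dif_pos hi]

theorem vertex_δ {m : ℕ} (i : Fin (m + 2)) {t : ℕ} (ht : t ≤ m) :
    vertex (SimplexCategory.δ i) t = if t < i then t else t + 1 := by
  have h : vertex (SimplexCategory.δ i) t =
      (i.succAbove ⟨min t m, Nat.lt_succ_of_le (min_le_right t m)⟩ : ℕ) := rfl
  rw [h]
  simp only [Fin.succAbove, Fin.lt_def, min_eq_left ht, Fin.val_castSucc]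
  split_ifs <;> simp

/-- The faces of the classifying complex are the classical ones:
`d_i (g_m, …, g_0) = (d_{i-1} g_m, …, d_1 g_{m-i+2}, (d_0 g_{m-i+1}) g_{m-i}, g_{m-i-1}, …, g_0)`. -/
theorem wbarMap_δ (G : SimplicialObject GrpCat.{u}) {m : ℕ} (i : Fin (m + 2))
    (g : (k : Fin (m + 1)) → G _⦋k⦌) (j : Fin m) :
    wbarMap G (SimplexCategory.δ i) g j =
      if h : m - j < (i : ℕ) then
        G.δ (⟨i - (m - j), by omega⟩ : Fin (j + 2)) (g ⟨j + 1, by omega⟩)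
      else if m - j = (i : ℕ) then
        G.δ (0 : Fin (j + 2)) (g ⟨j + 1, by omega⟩) * g ⟨j, by omega⟩
      else g ⟨j, by omega⟩ := by
  obtain ⟨j, hj⟩ := j
  set ψ : ⦋j⦌ ⟶ ⦋m + 1⦌ := lastVertices hj.le ≫ SimplexCategory.δ i with hψ
  have hv : ∀ t, t ≤ j → vertex ψ t = if t + (m - j) < i then t + (m - j) else t + (m - j) + 1 := by
    intro t ht
    rw [hψ, vertex_comp, vertex_lastVertices, min_eq_left ht, vertex_δ i (by omega)]
  change transition G g (vertex (SimplexCategory.δ i) (m - j - 1))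
    (vertex (SimplexCategory.δ i) (m - j)) ψ = _
  rw [vertex_δ i (by omega), vertex_δ i (by omega)]
  have key1 : ∀ k : Fin (j + 2), (i : ℕ) = (m - j) + k →
      G.map (toLast ψ (j + 1)).op (g ⟨j + 1, by omega⟩) = G.δ k (g ⟨j + 1, by omega⟩) := by
    intro k hk
    have : toLast ψ (j + 1) = SimplexCategory.δ k := by
      refine hom_ext fun t ht => ?_
      rw [vertex_toLast, vertex_δ k ht, min_eq_left ht, hv t ht]
      split_ifs <;> omega
    rw [this]
    rfl
  have key2 : (i : ℕ) ≤ m - j →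
      G.map (toLast ψ j).op (g ⟨j, by omega⟩) = g ⟨j, by omega⟩ := by
    intro hk
    have : toLast ψ j = 𝟙 ⦋j⦌ := by
      refine hom_ext fun t ht => ?_
      rw [vertex_toLast, vertex_id, min_eq_left ht, hv t ht]
      split_ifs <;> omega
    rw [this, op_id, G.map_id]
    rfl
  by_cases h1 : m - j < (i : ℕ)
  · rw [dif_pos h1, if_pos h1, if_pos (by omega), ← key1 _ (by simp only; omega)]
    have h := transition_succ G g (m - j - 1) ψ (i := j + 1) (by omega) (by omega)
    rwa [show m - j - 1 + 1 = m - j by omega] at h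
  · rw [dif_neg h1, if_neg h1]
    by_cases h2 : m - j = (i : ℕ)
    · rw [if_pos h2, if_pos (by omega), ← key1 0 (by simp only [Fin.val_zero]; omega)]
      have h := transition_succ G g (m - j - 1) ψ (i := j + 1) (by omega) (by omega)
      have h' := transition_succ G g (m - j) ψ (i := j) (by omega) (by omega)
      rw [show m - j - 1 + 1 = m - j by omega] at h
      rw [← transition_mul G g (b := m - j) (by omega) (by omega), h, h', key2 (by omega)]
    · rw [if_neg h2, if_neg (by omega)]
      have h' := transition_succ G g (m - j) ψ (i := j) (by omega) (by omega)
      rw [show m - j - 1 + 1 = m - j by omega, h', key2 (by omega)]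

/-- The vertex of `W̄G` (there is exactly one). -/
def wbarPt (G : SimplicialObject GrpCat.{u}) : (wbar G) _⦋0⦌ := fun i => i.elim0

/-! ### Homotopy groups of a pointed simplicial set -/

/-- The underlying set of `π_n(X, x)`, for a Kan complex `X`: the `n`-simplices of `X` all of whose
faces are at `x`, where `f` and `g` are identified if there is an `(n+1)`-simplex with
`d_n = f`, `d_{n+1} = g` and all its other faces at `x`. -/
def HomotopySet (X : SSet.{u}) (n : ℕ) (x : X _⦋0⦌) : Type u :=
  Quot fun f g : X.PtSimplex n x => Nonempty (SSet.PtSimplex.RelStruct f g (Fin.last n))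

/-- The class of an `n`-simplex in `π_n(X, x)`. -/
def HomotopySet.mk {X : SSet.{u}} {n : ℕ} {x : X _⦋0⦌} (f : X.PtSimplex n x) :
    HomotopySet X n x :=
  Quot.mk _ f

/-- The group `A` is isomorphic to `π_n(X, x)` through a bijection that takes `1` to the class of
the constant simplex and, for `n ≥ 1`, the multiplication of `A` to that of `π_n(X, x)`. In the
latter `[f] [g] = [h]` holds if and only if there is an `(n+1)`-simplex with `d_{n-1} = g`,
`d_n = h`, `d_{n+1} = f` and all its other faces at `x`. For `n = 0` this is a bijection of
pointed sets. -/
def IsoHomotopyGroup (A : Type u) [Group A] (X : SSet.{u}) (n : ℕ) (x : X _⦋0⦌) : Prop :=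
  ∃ e : A ≃ HomotopySet X n x,
    e 1 = HomotopySet.mk SSet.RelativeMorphism.const ∧
    ∀ i : Fin n, (i : ℕ) + 1 = n → ∀ f g h : X.PtSimplex n x,
      Nonempty (SSet.PtSimplex.MulStruct f g h i) ↔
        e.symm (HomotopySet.mk f) * e.symm (HomotopySet.mk g) = e.symm (HomotopySet.mk h)

end ThreeCrossed

namespace ThreeCrossed

/-! The heart of the proof is that passing from $G$ to $\overline WG$ shifts homotopy by one degree:
$\pi_{n+1}(\overline WG)$ is the homology $H_n(NG)$ of the Moore complex. The face $d_0$ of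
$\overline WG$ only forgets the top component, so a simplex with trivial $d_0$ has the form
$(z,1,\dots,1)$ (`eq_topSimplex_of_δ_zero`), and $d_{i+1}$ sends it to $(d_iz,1,\dots,1)$
(`wbarMap_δ_succ_topSimplex`). Hence pointed $(n+1)$-simplices are the same as elements $z\in G_n$
with all faces trivial (`ptSimplexEquiv`).

A simplex witnessing $[f][g]=[h]$ becomes an element $w\in G_{n+1}$ with three prescribed faces.
Multiplying $w$ by degenerate elements clears all faces but the last, which becomes $fgh^{-1}$; so
the relation holds exactly when $fgh^{-1}$ is a boundary (`nonempty_mulStruct_iff`). Homotopy is the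
case of a constant factor, so `isoHomotopyGroup_succ` yields set and group law together, with no
appeal to the Kan condition.

It remains to compare $H_n(NG)$ with the complex $K\to L\to M\to N$. Replacing $NG_3$ by its
quotient by $B=\partial_4(NG_4\cap D_4)\subseteq\ker\partial_3$ does not change the image of
$\partial_3$, so $\pi'_1,\pi'_2,\pi'_3$ are $H_0,H_1,H_2$. The kernel of the induced map is
$\ker\partial_3/B$, which is $H_3$ once $NG_4\subseteq D_4$ makes $B$ the full image of
$\partial_4$. -/

/-! ### Simplices of `W̄G` concentrated in the top component -/

/-- The simplex `(z, 1, …, 1)` of `W̄G`. -/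
def topSimplex (G : SimplicialObject GrpCat.{u}) (n : ℕ) (z : G _⦋n⦌) :
    (i : Fin (n + 1)) → G _⦋i⦌ :=
  Pi.mulSingle (Fin.last n) z

theorem topSimplex_last (G : SimplicialObject GrpCat.{u}) (n : ℕ) (z : G _⦋n⦌) :
    topSimplex G n z (Fin.last n) = z :=
  Pi.mulSingle_eq_same _ _

theorem topSimplex_of_lt (G : SimplicialObject GrpCat.{u}) (n : ℕ) (z : G _⦋n⦌)
    (i : Fin (n + 1)) (hi : (i : ℕ) < n) : topSimplex G n z i = 1 :=
  Pi.mulSingle_eq_of_ne (by rintro rfl; simp at hi) _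

theorem topSimplex_one (G : SimplicialObject GrpCat.{u}) (n : ℕ) :
    topSimplex G n 1 = fun _ => 1 :=
  Pi.mulSingle_one _

theorem eq_topSimplex_iff {G : SimplicialObject GrpCat.{u}} {n : ℕ}
    {y : (i : Fin (n + 1)) → G _⦋i⦌} {z : G _⦋n⦌} :
    y = topSimplex G n z ↔ y (Fin.last n) = z ∧ ∀ i : Fin (n + 1), (i : ℕ) < n → y i = 1 := by
  constructor
  · rintro rfl
    exact ⟨topSimplex_last G n z, topSimplex_of_lt G n z⟩
  · rintro ⟨h1, h2⟩
    funext i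
    rcases lt_or_eq_of_le (Nat.le_of_lt_succ i.isLt) with hi | hi
    · rw [h2 i hi, topSimplex_of_lt G n z i hi]
    · obtain rfl : i = Fin.last n := Fin.ext hi
      rw [h1, topSimplex_last]

theorem wbarMap_δ_zero (G : SimplicialObject GrpCat.{u}) {m : ℕ}
    (y : (k : Fin (m + 1)) → G _⦋k⦌) (j : Fin m) :
    wbarMap G (SimplexCategory.δ 0) y j = y ⟨j, by omega⟩ := by
  rw [wbarMap_δ, dif_neg (by simp), if_neg (by simp; omega)]

/-- The top component of a face other than `d_0, d_1`. -/
theorem wbarMap_δ_succ_succ_last (G : SimplicialObject GrpCat.{u}) {m : ℕ}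
    (y : (k : Fin (m + 2)) → G _⦋k⦌) (i : Fin (m + 1)) :
    wbarMap G (SimplexCategory.δ i.succ.succ) y (Fin.last m) = G.δ i.succ (y (Fin.last (m + 1))) := by
  rw [wbarMap_δ, dif_pos (by simp)]
  have h : (⟨(i.succ.succ : ℕ) - (m + 1 - (Fin.last m : ℕ)), by simp; omega⟩ : Fin (m + 2)) =
      i.succ := by
    ext; simp
  exact congrArg (fun k : Fin (m + 2) => G.δ k (y (Fin.last (m + 1)))) h

/-- The top component of the face `d_1`. -/
theorem wbarMap_δ_one_last (G : SimplicialObject GrpCat.{u}) {m : ℕ}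
    (y : (k : Fin (m + 2)) → G _⦋k⦌) :
    wbarMap G (SimplexCategory.δ 1) y (Fin.last m) =
      G.δ 0 (y (Fin.last (m + 1))) * y ⟨m, by omega⟩ := by
  rw [wbarMap_δ, dif_neg (by simp), if_pos (by simp)]
  rfl

/-- Component $j$ of a face involves only components $j$ and $j+1$ of the simplex, and both lie
below the top one here. -/
theorem wbarMap_δ_eq_one (G : SimplicialObject GrpCat.{u}) {m : ℕ}
    (y : (k : Fin (m + 1)) → G _⦋k⦌) (hy : ∀ k : Fin (m + 1), (k : ℕ) < m → y k = 1)
    (i : Fin (m + 2)) (j : Fin m) (hj : (j : ℕ) + 1 < m) :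
    wbarMap G (SimplexCategory.δ i) y j = 1 := by
  rw [wbarMap_δ]
  split_ifs
  · rw [hy _ (by simpa using hj), map_one]
  · rw [hy _ (by simpa using hj), hy _ (by simp), map_one, one_mul]
  · exact hy _ (by simp)

theorem wbarMap_δ_zero_topSimplex (G : SimplicialObject GrpCat.{u}) (n : ℕ) (z : G _⦋n⦌) :
    wbarMap G (SimplexCategory.δ 0) (topSimplex G n z) = fun _ => 1 := by
  funext j
  rw [wbarMap_δ_zero]
  exact topSimplex_of_lt G n z _ j.isLt

/-- This is the degree shift: the extra face $d_0$ of $\overline WG$ is trivial on such simplices,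
and the others are the faces of $G$ renumbered by one. For $d_1$ the top component is the product
$(d_0z)\cdot 1$. -/
theorem wbarMap_δ_succ_topSimplex (G : SimplicialObject GrpCat.{u}) (n : ℕ) (z : G _⦋n + 1⦌)
    (i : Fin (n + 2)) :
    wbarMap G (SimplexCategory.δ i.succ) (topSimplex G (n + 1) z) =
      topSimplex G n (G.δ i z) := by
  rw [eq_topSimplex_iff]
  refine ⟨?_, fun j hj => wbarMap_δ_eq_one G _ (topSimplex_of_lt G _ z) _ _ (by omega)⟩
  cases i using Fin.cases with
  | zero =>
    rw [Fin.succ_zero_eq_one, wbarMap_δ_one_last, topSimplex_last,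
      topSimplex_of_lt G (n + 1) z _ (by simp)]
    exact mul_one _
  | succ i => rw [wbarMap_δ_succ_succ_last, topSimplex_last]

theorem topSimplex_injective (G : SimplicialObject GrpCat.{u}) (n : ℕ) :
    Function.Injective (topSimplex G n) := fun a b h => by
  rw [← topSimplex_last G n a, h, topSimplex_last]

/-- The face $d_0$ keeps every component except the top one unchanged, so its triviality kills all
the lower components. -/
theorem eq_topSimplex_of_δ_zero {G : SimplicialObject GrpCat.{u}} {n : ℕ}
    {y : (i : Fin (n + 1)) → G _⦋i⦌}
    (hy : wbarMap G (SimplexCategory.δ 0) y = fun _ => 1) :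
    y = topSimplex G n (y (Fin.last n)) := by
  rw [eq_topSimplex_iff]
  refine ⟨rfl, fun i hi => ?_⟩
  have := congrFun hy ⟨i, hi⟩
  rwa [wbarMap_δ_zero] at this

/-! ### Cycles and boundaries -/

/-- The elements of `G_n` all of whose faces are trivial. -/
def cycles (G : SimplicialObject GrpCat.{u}) (n : ℕ) : Subgroup (G _⦋n⦌) :=
  match n with
  | 0 => ⊤
  | n + 1 => ⨅ i : Fin (n + 2), (G.δ i).hom.ker

theorem mem_cycles_succ {G : SimplicialObject GrpCat.{u}} {n : ℕ} {x : G _⦋n + 1⦌} :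
    x ∈ cycles G (n + 1) ↔ ∀ i : Fin (n + 2), G.δ i x = 1 := by
  simp only [cycles, Subgroup.mem_iInf]
  rfl

theorem mem_cycles_succ_iff {G : SimplicialObject GrpCat.{u}} {n : ℕ} {x : G _⦋n + 1⦌} :
    x ∈ cycles G (n + 1) ↔ ∃ h : x ∈ moore G (n + 1), mooreD G n ⟨x, h⟩ = 1 := by
  simp only [mem_cycles_succ, mem_moore_succ, Subtype.ext_iff]
  exact Fin.forall_fin_succ'.trans exists_prop.symm

/-- The boundaries in `G_n`. -/
def IsBoundary (G : SimplicialObject GrpCat.{u}) (n : ℕ) (x : G _⦋n⦌) : Prop :=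
  ∃ y ∈ moore G (n + 1), G.δ (Fin.last (n + 1)) y = x

theorem δ_castSucc_σ (G : SimplicialObject GrpCat.{u}) {n : ℕ} (i : Fin (n + 1)) (x : G _⦋n⦌) :
    G.δ i.castSucc (G.σ i x) = x :=
  ConcreteCategory.congr_hom (G.δ_comp_σ_self (i := i)) x

theorem δ_succ_σ (G : SimplicialObject GrpCat.{u}) {n : ℕ} (i : Fin (n + 1)) (x : G _⦋n⦌) :
    G.δ i.succ (G.σ i x) = x :=
  ConcreteCategory.congr_hom (G.δ_comp_σ_succ (i := i)) x

/-- The faces of a degenerate cycle other than the two obvious ones are trivial. -/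
theorem δ_σ_eq_one {G : SimplicialObject GrpCat.{u}} {n : ℕ} {x : G _⦋n + 1⦌}
    (hx : x ∈ cycles G (n + 1)) (i : Fin (n + 2)) (j : Fin (n + 3)) (h1 : j ≠ i.castSucc)
    (h2 : j ≠ i.succ) : G.δ j (G.σ i x) = 1 := by
  rw [mem_cycles_succ] at hx
  -- The identities $d_js_i=s_{i-1}d_j$ for $j<i$ and $d_js_i=s_id_{j-1}$ for $j>i+1$ exhibit the
  -- face as a degeneracy of a face of `x`.
  rcases lt_or_gt_of_ne h1 with h | h
  · obtain ⟨i, rfl⟩ := Fin.exists_succ_eq.2 (show i ≠ 0 by rintro rfl; simp at h)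
    obtain ⟨j, rfl⟩ := Fin.exists_castSucc_eq.2 (show j ≠ Fin.last _ by
      rintro rfl; exact absurd h (Fin.le_last _).not_gt)
    have := ConcreteCategory.congr_hom (G.δ_comp_σ_of_le (i := j) (j := i)
      (by simp only [Fin.lt_def, Fin.le_def, Fin.val_castSucc, Fin.val_succ] at h ⊢; omega)) x
    rw [CategoryTheory.comp_apply, CategoryTheory.comp_apply, hx, map_one] at this
    exact this
  · have h3 : i.succ < j := lt_of_le_of_ne (Fin.castSucc_lt_iff_succ_le.1 h) h2.symm
    obtain ⟨i, rfl⟩ := Fin.exists_castSucc_eq.2 (show i ≠ Fin.last _ by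
      rintro rfl; rw [Fin.succ_last] at h3; exact absurd h3 (Fin.le_last _).not_gt)
    obtain ⟨j, rfl⟩ := Fin.exists_succ_eq.2 (show j ≠ 0 by rintro rfl; simp at h)
    have := ConcreteCategory.congr_hom (G.δ_comp_σ_of_gt (i := j) (j := i)
      (by simp only [Fin.lt_def, Fin.val_castSucc, Fin.val_succ] at h3 ⊢; omega)) x
    rw [CategoryTheory.comp_apply, CategoryTheory.comp_apply, hx, map_one] at this
    exact this

/-- For cycles `f, g, h`, the product `f g h⁻¹` is a boundary if and only if there is a simplex with
the faces required in the definition of the product of homotopy classes. -/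
theorem isBoundary_mul_mul_inv_iff {G : SimplicialObject GrpCat.{u}} {n : ℕ} {f g h : G _⦋n + 1⦌}
    (hg : g ∈ cycles G (n + 1)) (hh : h ∈ cycles G (n + 1)) :
    IsBoundary G (n + 1) (f * g * h⁻¹) ↔ ∃ w : G _⦋n + 2⦌,
      G.δ (Fin.last n).castSucc.castSucc w = g ∧ G.δ (Fin.last (n + 1)).castSucc w = h ∧
      G.δ (Fin.last (n + 2)) w = f ∧
      ∀ j : Fin n, G.δ j.castSucc.castSucc.castSucc w = 1 := by
  have hhg : h * g⁻¹ ∈ cycles G (n + 1) := mul_mem hh (inv_mem hg)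
  have a1 := δ_castSucc_σ G (Fin.last (n + 1)) (h * g⁻¹)
  have a2 := δ_succ_σ G (Fin.last (n + 1)) (h * g⁻¹)
  have b1 := δ_castSucc_σ G (Fin.last n).castSucc g
  have b2 := δ_succ_σ G (Fin.last n).castSucc g
  rw [Fin.succ_last] at a2
  rw [← Fin.castSucc_succ, Fin.succ_last] at b2
  have a3 : ∀ j : Fin (n + 1), G.δ j.castSucc.castSucc (G.σ (Fin.last (n + 1)) (h * g⁻¹)) = 1 :=
    fun j => δ_σ_eq_one hhg _ _ (by simp [Fin.ext_iff]; omega) (by simp [Fin.ext_iff]; omega)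
  have b3 : ∀ j : Fin n,
      G.δ j.castSucc.castSucc.castSucc (G.σ (Fin.last n).castSucc g) = 1 :=
    fun j => δ_σ_eq_one hg _ _ (by simp [Fin.ext_iff]; omega) (by simp [Fin.ext_iff]; omega)
  have b4 : G.δ (Fin.last (n + 2)) (G.σ (Fin.last n).castSucc g) = 1 :=
    δ_σ_eq_one hg _ _ (by simp [Fin.ext_iff]) (by simp [Fin.ext_iff])
  constructor
  · rintro ⟨v, hv, hvl⟩
    rw [mem_moore_succ] at hv
    -- The factor $s_ng$ has $d_n=d_{n+1}=g$, and $s_{n+1}(hg^{-1})$ has $d_{n+1}=d_{n+2}=hg^{-1}$;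
    -- their other faces are trivial. The product therefore has $d_n=g$, $d_{n+1}=hg^{-1}g=h$ and
    -- $d_{n+2}=fgh^{-1}\cdot hg^{-1}=f$.
    refine ⟨v * G.σ (Fin.last (n + 1)) (h * g⁻¹) * G.σ (Fin.last n).castSucc g, ?_, ?_, ?_, ?_⟩
    · rw [map_mul, map_mul, hv, a3, b1]; group
    · rw [map_mul, map_mul, hv, a1, b2]; group
    · rw [map_mul, map_mul, hvl, a2, b4]; group
    · intro j
      rw [map_mul, map_mul, hv, a3, b3]; group
  · rintro ⟨w, h1, h2, h3, h4⟩
    -- Dividing by the same two degenerate elements clears every face but the last.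
    refine ⟨w * (G.σ (Fin.last n).castSucc g)⁻¹ * (G.σ (Fin.last (n + 1)) (h * g⁻¹))⁻¹, ?_, ?_⟩
    · rw [mem_moore_succ, Fin.forall_fin_succ']
      constructor
      · rw [Fin.forall_fin_succ']
        constructor
        · intro j
          rw [map_mul, map_mul, map_inv, map_inv, h4, a3, b3]; group
        · rw [map_mul, map_mul, map_inv, map_inv, h1, a3, b1]; group
      · rw [map_mul, map_mul, map_inv, map_inv, h2, a1, b2]; group
    · rw [map_mul, map_mul, map_inv, map_inv, h3, a2, b4]; group

/-! ### Pointed simplices of `W̄G` -/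

theorem yonedaEquiv_const_wbarPt (G : SimplicialObject GrpCat.{u}) (n : ℕ) :
    SSet.yonedaEquiv (SSet.const (wbarPt G) : Δ[n] ⟶ wbar G) =
      (fun _ => 1 : (i : Fin n) → G _⦋i⦌) := by
  funext j
  -- The constant simplex is pulled back from the empty tuple, so each factor of the transition
  -- product takes the default value $1$.
  refine List.prod_eq_one fun a ha => ?_
  obtain ⟨k, -, rfl⟩ := List.mem_map.1 ha
  exact dif_neg (Nat.not_lt_zero _)

theorem δ_comp_eq_iff {X : SSet.{u}} {n : ℕ} (y : Δ[n + 1] ⟶ X) (f : Δ[n] ⟶ X)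
    (i : Fin (n + 2)) :
    SSet.stdSimplex.δ i ≫ y = f ↔
      X.δ i (SSet.yonedaEquiv y) = SSet.yonedaEquiv f := by
  rw [← SSet.stdSimplex.yonedaEquiv_δ_comp]
  exact SSet.yonedaEquiv.injective.eq_iff.symm

/-- The `(n+1)`-simplices of `W̄G` with faces at the vertex are the cycles of `G_n`. -/
theorem forall_δ_eq_one_iff {G : SimplicialObject GrpCat.{u}} {n : ℕ}
    {y : (i : Fin (n + 1)) → G _⦋i⦌} :
    (∀ i, wbarMap G (SimplexCategory.δ i) y = fun _ => 1) ↔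
      ∃ z ∈ cycles G n, y = topSimplex G n z := by
  constructor
  · intro h
    refine ⟨_, ?_, eq_topSimplex_of_δ_zero (h 0)⟩
    cases n with
    | zero => exact Subgroup.mem_top _
    | succ n =>
      rw [mem_cycles_succ]
      intro i
      -- The simplex is $(z,1,\dots,1)$, so its trivial face $d_{i+1}$ is $(d_iz,1,\dots,1)$.
      apply topSimplex_injective
      rw [← wbarMap_δ_succ_topSimplex, ← eq_topSimplex_of_δ_zero (h 0), h, topSimplex_one]
  · rintro ⟨z, hz, rfl⟩ i
    cases i using Fin.cases with
    | zero => exact wbarMap_δ_zero_topSimplex G n z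
    | succ i =>
      cases n with
      | zero => funext j; exact j.elim0
      | succ n =>
        rw [mem_cycles_succ] at hz
        rw [wbarMap_δ_succ_topSimplex, hz, topSimplex_one]

/-- The cycle of a pointed simplex of `W̄G`. -/
def cycleOf {G : SimplicialObject GrpCat.{u}} {n : ℕ} (f : (wbar G).PtSimplex (n + 1) (wbarPt G)) :
    G _⦋n⦌ :=
  (SSet.yonedaEquiv f.map : (i : Fin (n + 1)) → G _⦋i⦌) (Fin.last n)

theorem yonedaEquiv_map_eq {G : SimplicialObject GrpCat.{u}} {n : ℕ}
    (f : (wbar G).PtSimplex (n + 1) (wbarPt G)) :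
    cycleOf f ∈ cycles G n ∧ SSet.yonedaEquiv f.map = topSimplex G n (cycleOf f) := by
  have h := (forall_δ_eq_one_iff (y := SSet.yonedaEquiv f.map)).1 fun i => by
    rw [← yonedaEquiv_const_wbarPt]
    exact (δ_comp_eq_iff _ _ i).1 (f.δ_map i)
  obtain ⟨z, hz, h⟩ := h
  have : cycleOf f = z := by rw [cycleOf, h, topSimplex_last]
  exact ⟨this ▸ hz, this ▸ h⟩

/-- The pointed simplex of a cycle. -/
def ofCycle {G : SimplicialObject GrpCat.{u}} {n : ℕ} (z : cycles G n) :
    (wbar G).PtSimplex (n + 1) (wbarPt G) where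
  map := SSet.yonedaEquiv.symm (topSimplex G n z : (wbar G) _⦋n + 1⦌)
  comm := by
    refine SSet.boundary.hom_ext fun i => ?_
    rw [SSet.boundary.ι_ι_assoc]
    refine (δ_comp_eq_iff _ _ i).2 ?_
    refine (congrArg (wbarMap G (SimplexCategory.δ i))
      (SSet.yonedaEquiv.apply_symm_apply _)).trans ?_
    have hz : ∃ z' ∈ cycles G n, topSimplex G n (z : G _⦋n⦌) = topSimplex G n z' := ⟨z, z.2, rfl⟩
    refine (forall_δ_eq_one_iff.2 hz i).trans ?_
    exact (yonedaEquiv_const_wbarPt G n).symm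

theorem cycleOf_ofCycle {G : SimplicialObject GrpCat.{u}} {n : ℕ} (z : cycles G n) :
    cycleOf (ofCycle z) = z := by
  have h : SSet.yonedaEquiv (ofCycle z).map = topSimplex G n z :=
    SSet.yonedaEquiv.apply_symm_apply _
  rw [cycleOf, h, topSimplex_last]

/-- Pointed `(n+1)`-simplices of `W̄G` correspond to cycles in `G_n`. -/
def ptSimplexEquiv (G : SimplicialObject GrpCat.{u}) (n : ℕ) :
    (wbar G).PtSimplex (n + 1) (wbarPt G) ≃ cycles G n where
  toFun f := ⟨cycleOf f, (yonedaEquiv_map_eq f).1⟩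
  invFun := ofCycle
  left_inv f := by
    apply SSet.RelativeMorphism.ext
    apply SSet.yonedaEquiv.injective
    rw [(yonedaEquiv_map_eq f).2, (yonedaEquiv_map_eq _).2, cycleOf_ofCycle]
  right_inv z := Subtype.ext (cycleOf_ofCycle z)

theorem cycleOf_const (G : SimplicialObject GrpCat.{u}) (n : ℕ) :
    cycleOf (SSet.RelativeMorphism.const : (wbar G).PtSimplex (n + 1) (wbarPt G)) = 1 :=
  congrFun (yonedaEquiv_const_wbarPt G (n + 1)) (Fin.last n)

/-! ### Homotopy groups of `W̄G` -/

theorem nonempty_mulStruct_iff_exists {G : SimplicialObject GrpCat.{u}} {n : ℕ}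
    {f g h : (wbar G).PtSimplex (n + 1) (wbarPt G)} :
    Nonempty (SSet.PtSimplex.MulStruct f g h (Fin.last n)) ↔
      ∃ y : (i : Fin (n + 2)) → G _⦋i⦌,
        wbarMap G (SimplexCategory.δ (Fin.last n).castSucc.castSucc) y =
          topSimplex G n (cycleOf g) ∧
        wbarMap G (SimplexCategory.δ (Fin.last n).castSucc.succ) y =
          topSimplex G n (cycleOf h) ∧
        wbarMap G (SimplexCategory.δ (Fin.last n).succ.succ) y = topSimplex G n (cycleOf f) ∧
        ∀ j : Fin n, wbarMap G (SimplexCategory.δ j.castSucc.castSucc.castSucc) y =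
          fun _ => 1 := by
  rw [← (yonedaEquiv_map_eq f).2, ← (yonedaEquiv_map_eq g).2, ← (yonedaEquiv_map_eq h).2,
    ← yonedaEquiv_const_wbarPt]
  constructor
  · rintro ⟨s⟩
    exact ⟨SSet.yonedaEquiv s.map, (δ_comp_eq_iff _ _ _).1 s.δ_castSucc_castSucc_map,
      (δ_comp_eq_iff _ _ _).1 s.δ_succ_castSucc_map, (δ_comp_eq_iff _ _ _).1 s.δ_succ_succ_map,
      fun j => (δ_comp_eq_iff _ _ _).1 (s.δ_map_of_lt _ (by simp [Fin.lt_def]))⟩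
  · rintro ⟨y, hg, hh, hf, hc⟩
    obtain ⟨s, rfl⟩ := (SSet.yonedaEquiv (X := wbar G) (n := ⦋n + 2⦌)).surjective y
    refine ⟨⟨s, (δ_comp_eq_iff _ _ _).2 hg, (δ_comp_eq_iff _ _ _).2 hh,
      (δ_comp_eq_iff _ _ _).2 hf, fun j hj => (δ_comp_eq_iff _ _ _).2 ?_, fun j hj => ?_⟩⟩
    · have hj' : (j : ℕ) < n := by simpa [Fin.lt_def] using hj
      exact hc ⟨j, hj'⟩
    -- The product is formed at the last index, so no face comes after the three prescribed ones.
    · rw [Fin.succ_last, Fin.succ_last] at hj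
      exact absurd hj (Fin.le_last j).not_gt

/-- The lowest degree is separate because a 2-simplex $(w,g)$ of $\overline WG$ need not have
trivial $d_0$: its faces are $g$, $(d_0w)g$ and $d_1w$. The correction by $s_0(hg^{-1})$ is the same
as in higher degrees; no term $s_ng$ is needed. -/
theorem isBoundary_mul_mul_inv_iff_zero {G : SimplicialObject GrpCat.{u}} {f g h : G _⦋0⦌} :
    IsBoundary G 0 (f * g * h⁻¹) ↔ ∃ w : G _⦋1⦌, G.δ 0 w * g = h ∧ G.δ 1 w = f := by
  have a1 : G.δ 0 (G.σ 0 (h * g⁻¹)) = h * g⁻¹ := δ_castSucc_σ G 0 _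
  have a2 : G.δ 1 (G.σ 0 (h * g⁻¹)) = h * g⁻¹ := δ_succ_σ G 0 _
  constructor
  · rintro ⟨v, hv, hvl⟩
    have hv0 : G.δ 0 v = 1 := mem_moore_succ.1 hv 0
    have hv1 : G.δ 1 v = f * g * h⁻¹ := hvl
    refine ⟨v * G.σ 0 (h * g⁻¹), ?_, ?_⟩
    · rw [map_mul, hv0, a1]; group
    · rw [map_mul, hv1, a2]; group
  · rintro ⟨w, hh, hf⟩
    refine ⟨w * (G.σ 0 (h * g⁻¹))⁻¹, ?_, ?_⟩
    · rw [mem_moore_succ, Fin.forall_fin_one]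
      change G.δ 0 _ = 1
      rw [map_mul, map_inv, a1, ← hh]; group
    · change G.δ 1 _ = _
      rw [map_mul, map_inv, a2, hf]; group

theorem exists_simplex_two (G : SimplicialObject GrpCat.{u}) (w : G _⦋1⦌) (g : G _⦋0⦌) :
    ∃ y : (i : Fin 2) → G _⦋i⦌, y (Fin.last 1) = w ∧ y ⟨0, by omega⟩ = g :=
  ⟨Fin.cons (α := fun i : Fin 2 => G _⦋i⦌) g (fun i => topSimplex G 1 w i.succ),
    topSimplex_last G 1 w, rfl⟩

theorem nonempty_mulStruct_iff {G : SimplicialObject GrpCat.{u}} {n : ℕ}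
    {f g h : (wbar G).PtSimplex (n + 1) (wbarPt G)} :
    Nonempty (SSet.PtSimplex.MulStruct f g h (Fin.last n)) ↔
      IsBoundary G n (cycleOf f * cycleOf g * (cycleOf h)⁻¹) := by
  rw [nonempty_mulStruct_iff_exists]
  cases n with
  | zero =>
    have e : ∀ (y : (i : Fin 1) → G _⦋i⦌) (z : G _⦋0⦌), y = topSimplex G 0 z ↔ y (Fin.last 0) = z :=
      fun y z => eq_topSimplex_iff.trans ⟨fun h => h.1, fun h => ⟨h, fun _ hi => absurd hi (by simp)⟩⟩
    rw [isBoundary_mul_mul_inv_iff_zero]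
    simp only [e]
    constructor
    · rintro ⟨y, hg, hh, hf, -⟩
      have hg : y ⟨0, by omega⟩ = cycleOf g := (wbarMap_δ_zero G y 0).symm.trans hg
      have hh := (wbarMap_δ_one_last G y).symm.trans hh
      have hf := (wbarMap_δ_succ_succ_last G y 0).symm.trans hf
      rw [hg] at hh
      exact ⟨y (Fin.last 1), hh, hf⟩
    · rintro ⟨w, hh, hf⟩
      obtain ⟨y, rfl, hg⟩ := exists_simplex_two G w (cycleOf g)
      refine ⟨y, (wbarMap_δ_zero G y 0).trans hg, (wbarMap_δ_one_last G y).trans ?_,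
        (wbarMap_δ_succ_succ_last G y 0).trans hf, fun j => j.elim0⟩
      rw [hg]
      exact hh
  | succ n =>
    rw [isBoundary_mul_mul_inv_iff (yonedaEquiv_map_eq g).1 (yonedaEquiv_map_eq h).1]
    have key : ∀ (w : G _⦋n + 2⦌) (i : Fin (n + 3)) (k : Fin (n + 4)) (z : G _⦋n + 1⦌),
        k = i.succ →
        (wbarMap G (SimplexCategory.δ k) (topSimplex G (n + 2) w) = topSimplex G (n + 1) z ↔
          G.δ i w = z) := by
      rintro w i _ z rfl
      rw [wbarMap_δ_succ_topSimplex]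
      exact (topSimplex_injective G (n + 1)).eq_iff
    -- Writing trivial faces as $(1,\dots,1)$ with top component $1$ lets `key` treat them like the
    -- three prescribed faces.
    simp only [← topSimplex_one G (n + 1)]
    constructor
    · rintro ⟨y, hg, hh, hf, hc⟩
      -- In this degree $d_0$ lies below the three prescribed faces, so it is among those required
      -- to be trivial.
      have h0 : wbarMap G (SimplexCategory.δ 0) y = fun _ => 1 :=
        (hc 0).trans (topSimplex_one G (n + 1))
      have hy := eq_topSimplex_of_δ_zero h0
      generalize y (Fin.last (n + 2)) = w at hy
      subst hy
      exact ⟨w, (key w (Fin.last n).castSucc.castSucc _ _ rfl).1 hg,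
        (key w (Fin.last (n + 1)).castSucc _ _ rfl).1 hh, (key w (Fin.last (n + 2)) _ _ rfl).1 hf,
        fun j => (key w j.castSucc.castSucc.castSucc _ _ rfl).1 (hc j.succ)⟩
    · rintro ⟨w, hg, hh, hf, hc⟩
      refine ⟨topSimplex G (n + 2) w, (key w (Fin.last n).castSucc.castSucc _ _ rfl).2 hg,
        (key w (Fin.last (n + 1)).castSucc _ _ rfl).2 hh, (key w (Fin.last (n + 2)) _ _ rfl).2 hf,
        fun j => ?_⟩
      cases j using Fin.cases with
      | zero => exact (wbarMap_δ_zero_topSimplex G _ w).trans (topSimplex_one G (n + 1)).symm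
      | succ j => exact (key w j.castSucc.castSucc.castSucc _ _ rfl).2 (hc j)

/-- A quotient of the group of cycles of `G_n` by the boundaries is `π_{n+1}(W̄G)`. -/
theorem isoHomotopyGroup_succ {G : SimplicialObject GrpCat.{u}} {n : ℕ} {A : Type u} [Group A]
    (q : cycles G n →* A) (hq : Function.Surjective q)
    (hker : ∀ z : cycles G n, q z = 1 ↔ IsBoundary G n z) :
    IsoHomotopyGroup A (wbar G) (n + 1) (wbarPt G) := by
  have hmul : ∀ f g h : (wbar G).PtSimplex (n + 1) (wbarPt G),
      Nonempty (SSet.PtSimplex.MulStruct f g h (Fin.last n)) ↔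
        q (ptSimplexEquiv G n f) * q (ptSimplexEquiv G n g) = q (ptSimplexEquiv G n h) := by
    intro f g h
    rw [nonempty_mulStruct_iff, ← mul_inv_eq_one, ← map_mul, ← map_inv, ← map_mul, hker]
    rfl
  have hconst : q (ptSimplexEquiv G n SSet.RelativeMorphism.const) = 1 := by
    rw [show ptSimplexEquiv G n SSet.RelativeMorphism.const = 1 from
      Subtype.ext (cycleOf_const G n), map_one]
  have hrel : ∀ f g : (wbar G).PtSimplex (n + 1) (wbarPt G),
      Nonempty (SSet.PtSimplex.RelStruct f g (Fin.last (n + 1))) ↔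
        q (ptSimplexEquiv G n f) = q (ptSimplexEquiv G n g) := by
    intro f g
    -- A homotopy is a multiplication witness whose second factor is constant, so `hmul` already
    -- decides it.
    rw [← Fin.succ_last, SSet.PtSimplex.relStructSuccEquivMulStruct.nonempty_congr, hmul, hconst,
      mul_one, eq_comm]
  -- By `hrel` the relation is equality of values of `q`, hence already an equivalence; `Quot` makes
  -- no further identifications.
  let e : HomotopySet (wbar G) (n + 1) (wbarPt G) → A :=
    Quot.lift (fun f => q (ptSimplexEquiv G n f)) fun f g h => (hrel f g).1 h
  have he : Function.Bijective e := by
    constructor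
    · rintro ⟨f⟩ ⟨g⟩ h
      exact Quot.sound ((hrel f g).2 h)
    · intro a
      obtain ⟨z, rfl⟩ := hq a
      exact ⟨Quot.mk _ ((ptSimplexEquiv G n).symm z),
        congrArg q ((ptSimplexEquiv G n).apply_symm_apply z)⟩
  refine ⟨(Equiv.ofBijective e he).symm, ?_, ?_⟩
  · rw [Equiv.symm_apply_eq]
    exact hconst.symm
  · intro i hi f g h
    obtain rfl : i = Fin.last n := Fin.ext (by simpa using hi)
    exact hmul f g h

theorem subsingleton_ptSimplex_zero (G : SimplicialObject GrpCat.{u}) :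
    Subsingleton ((wbar G).PtSimplex 0 (wbarPt G)) := by
  constructor
  intro f g
  apply SSet.RelativeMorphism.ext
  apply SSet.yonedaEquiv.injective
  funext i
  exact Fin.elim0 i

theorem isoHomotopyGroup_zero (G : SimplicialObject GrpCat.{u}) :
    IsoHomotopyGroup PUnit (wbar G) 0 (wbarPt G) := by
  have := subsingleton_ptSimplex_zero G
  refine ⟨⟨fun _ => HomotopySet.mk SSet.RelativeMorphism.const, fun _ => PUnit.unit,
    fun _ => rfl, ?_⟩, rfl, fun i => i.elim0⟩
  rintro ⟨f⟩
  exact congrArg _ (Subsingleton.elim _ _)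

/-! ### Comparison with the homotopy groups of the associated complex -/

theorem isBoundary_iff_mem_range {G : SimplicialObject GrpCat.{u}} {n : ℕ} (x : moore G n) :
    IsBoundary G n x ↔ x ∈ (mooreD G n).range := by
  constructor
  · rintro ⟨y, hy, h⟩
    exact ⟨⟨y, hy⟩, Subtype.ext h⟩
  · rintro ⟨y, rfl⟩
    exact ⟨y, y.2, rfl⟩

/-- The cycles of `G_{n+1}` are the kernel of the differential of the Moore complex. -/
def cyclesEquivKer (G : SimplicialObject GrpCat.{u}) (n : ℕ) :
    cycles G (n + 1) ≃* (mooreD G n).ker where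
  toFun z := ⟨⟨z, (mem_cycles_succ_iff.1 z.2).1⟩, (mem_cycles_succ_iff.1 z.2).2⟩
  invFun z := ⟨z, mem_cycles_succ_iff.2 ⟨z.1.2, z.2⟩⟩
  left_inv _ := rfl
  right_inv _ := rfl
  map_mul' _ _ := rfl

/-- The cycles in $G_{n+1}$ are $\ker\partial_{n+1}$, and $\overline WG$ raises the degree by one
more, whence $n+2$. -/
theorem isoHomotopyGroup_of_ker {G : SimplicialObject GrpCat.{u}} {n : ℕ} {A : Type u} [Group A]
    (q : (mooreD G n).ker →* A) (hq : Function.Surjective q)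
    (hker : ∀ z, q z = 1 ↔ (z : moore G (n + 1)) ∈ (mooreD G (n + 1)).range) :
    IsoHomotopyGroup A (wbar G) (n + 2) (wbarPt G) :=
  isoHomotopyGroup_succ (q.comp (cyclesEquivKer G n).toMonoidHom)
    (hq.comp (cyclesEquivKer G n).surjective)
    fun z => (hker _).trans (isBoundary_iff_mem_range (cyclesEquivKer G n z).1).symm

/-- Dividing the source by a subgroup of the kernel leaves the image unchanged, so $\pi'_3$ does not
see the quotient in degree three. -/
theorem range_assocComplex_d₃ (G : SimplicialObject GrpCat.{u}) :
    (assocComplex G).d₃.range = (mooreD G 2).range := by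
  ext x
  constructor
  · rintro ⟨k, rfl⟩
    obtain ⟨k, rfl⟩ := QuotientGroup.mk_surjective k
    exact ⟨k, rfl⟩
  · rintro ⟨k, rfl⟩
    exact ⟨QuotientGroup.mk k, rfl⟩

theorem isoHomotopyGroup_one (G : SimplicialObject GrpCat.{u}) :
    IsoHomotopyGroup ((assocComplex G).Pi 1) (wbar G) 1 (wbarPt G) := by
  let q : (assocComplex G).N →* (assocComplex G).N ⧸ (assocComplex G).d₁.range :=
    QuotientGroup.mk' _
  -- In degree zero there are no faces to kill: both subgroups are the whole of $G_0$ by definition.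
  let i : cycles G 0 →* moore G 0 := MonoidHom.id (moore G 0)
  have hs : Function.Surjective q := QuotientGroup.mk'_surjective _
  have hq : ∀ x, q x = 1 ↔ x ∈ (assocComplex G).d₁.range := fun x => QuotientGroup.eq_one_iff x
  refine isoHomotopyGroup_succ (A := (assocComplex G).N ⧸ (assocComplex G).d₁.range)
    (MonoidHom.comp q i) hs fun z => ?_
  exact (hq (i z)).trans (isBoundary_iff_mem_range (i z)).symm

theorem isoHomotopyGroup_two (G : SimplicialObject GrpCat.{u}) :
    IsoHomotopyGroup ((assocComplex G).Pi 2) (wbar G) 2 (wbarPt G) := by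
  have := mooreD_range_normal G 1
  exact isoHomotopyGroup_of_ker
    (A := (mooreD G 0).ker ⧸ (mooreD G 1).range.subgroupOf (mooreD G 0).ker)
    (QuotientGroup.mk' _) (QuotientGroup.mk'_surjective _) fun z => QuotientGroup.eq_one_iff _

theorem isoHomotopyGroup_three (G : SimplicialObject GrpCat.{u}) :
    IsoHomotopyGroup ((assocComplex G).Pi 3) (wbar G) 3 (wbarPt G) := by
  let q : (assocComplex G).d₂.ker →*
      (assocComplex G).d₂.ker ⧸ (assocComplex G).d₃.range.subgroupOf (assocComplex G).d₂.ker :=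
    QuotientGroup.mk' _
  have hs : Function.Surjective q := QuotientGroup.mk'_surjective _
  have hq : ∀ x, q x = 1 ↔ (x : (assocComplex G).L) ∈ (assocComplex G).d₃.range :=
    fun x => QuotientGroup.eq_one_iff x
  refine isoHomotopyGroup_of_ker
    (A := (assocComplex G).d₂.ker ⧸ (assocComplex G).d₃.range.subgroupOf (assocComplex G).d₂.ker)
    q hs fun z => ?_
  rw [← range_assocComplex_d₃]
  exact hq z

theorem degenBoundary_eq_range {G : SimplicialObject GrpCat.{u}} (hG : moore G 4 ≤ degen G 4) :
    degenBoundary G = (mooreD G 3).range := by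
  rw [degenBoundary, Subgroup.subgroupOf_eq_top.2 hG, ← MonoidHom.range_eq_map]

/-- The kernel of the map induced on $NG_3/B$ is $\ker\partial_3/B$, and the hypothesis makes $B$
the whole image of $\partial_4$. Without it, $B$ could be too small. -/
theorem isoHomotopyGroup_four {G : SimplicialObject GrpCat.{u}}
    (hG : moore G 4 ≤ degen G 4) :
    IsoHomotopyGroup ((assocComplex G).Pi 4) (wbar G) 4 (wbarPt G) := by
  let q : (mooreD G 2).ker →* (assocComplex G).d₃.ker :=
    ((QuotientGroup.mk' (degenBoundary G)).comp (mooreD G 2).ker.subtype).codRestrict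
      (assocComplex G).d₃.ker fun z => z.2
  refine isoHomotopyGroup_of_ker (A := (assocComplex G).d₃.ker) q ?_ fun z => ?_
  -- The induced map takes the class of $k$ to $\partial_3k$, so any representative of a class in
  -- its kernel lies in $\ker\partial_3$.
  · rintro ⟨k, hk⟩
    obtain ⟨k, rfl⟩ := QuotientGroup.mk_surjective k
    exact ⟨⟨k, hk⟩, rfl⟩
  · rw [← degenBoundary_eq_range hG]
    exact Subtype.ext_iff.trans (QuotientGroup.eq_one_iff _)

end ThreeCrossed

theorem proposition3 (G : SimplicialObject GrpCat.{u}) :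
    (∀ n : ℕ, n ≤ 3 → ThreeCrossed.IsoHomotopyGroup ((ThreeCrossed.assocComplex G).Pi n)
      (ThreeCrossed.wbar G) n (ThreeCrossed.wbarPt G)) ∧
    (ThreeCrossed.moore G 4 ≤ ThreeCrossed.degen G 4 →
      ThreeCrossed.IsoHomotopyGroup ((ThreeCrossed.assocComplex G).Pi 4)
        (ThreeCrossed.wbar G) 4 (ThreeCrossed.wbarPt G)) := by
  refine ⟨fun n hn => ?_, ThreeCrossed.isoHomotopyGroup_four⟩
  match n, hn with
  | 0, _ => exact ThreeCrossed.isoHomotopyGroup_zero G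
  | 1, _ => exact ThreeCrossed.isoHomotopyGroup_one G
  | 2, _ => exact ThreeCrossed.isoHomotopyGroup_two G
  | 3, _ => exact ThreeCrossed.isoHomotopyGroup_three G
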